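/- Let $n\ge 1$ and let $r$ be a positive integer with $r\equiv 2 \pmod 4$. Let $G_{r,n}=\mathbb{Z}_r\wr S_n$ be the group of colored permutations, i.e. the set of pairs $(\vec z,\tau)$ with $\vec z\in\mathbb{Z}_r^n$, $\tau\in S_n$, and multiplication $(\vec z,\tau)(\vec z\,',\tau')=\big((z_i+z'_{\tau^{-1}(i)})_{i=1}^n,\ \tau\circ\tau'\big)$. It is generated by $s_0=((1,0,\dots,0),\mathrm{id})$ and $s_i=(\vec 0,(i\ i{+}1))$ for $1\le i\le n-1$. Let $A_{r,n}=\ker\varphi$, where $\varphi:G_{r,n}\to\{1,-1\}$ is the unique homomorphism with $\varphi(s_i)=-1$ for all $0\le i\le n-1$. Put $a_0=s_0^2$, $a_i=s_0^{r/2}s_i$ for $1\le i\le n-1$, and $$\mathcal A=\{a_0,a_1,a_1^{-1},a_2,\dots,a_{n-1}\}$$ (so $\mathcal A=\{a_0\}$ if $n=1$). Then every element of $A_{r,n}$ is a product of elements of $\mathcal A$, and all such products lie in $A_{r,n}$. Let $\ell_{\mathcal A}(\pi)$ denote the least number $u$ of factors in an expression $\pi=g_1\cdots g_u$ with all $g_k\in\mathcal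 A$. Then, as polynomials in $q$ with rational coefficients, $$\sum_{\pi\in A_{r,n}} q^{\ell_{\mathcal A}(\pi)}=\frac12\,[n]!_q\prod_{j=1}^n\left(1+q^{j-1}\Big(1+\sum_{i=1}^{r/2-1}2q^{i}\Big)\right),$$ where $[n]!_q=\prod_{j=1}^n(1+q+\cdots+q^{j-1})$. -/

import Mathlib

/-- The underlying set of the group `G_{r,n} = ℤ_r ≀ S_n` of colored permutations of `n` digits with
`r` colors: pairs `(z, τ)` with `z` an `n`-tuple of elements of `ℤ/r` and `τ ∈ S_n`.
The digits `1, …, n` are represented by the elements `0, …, n - 1` of `Fin n`. -/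
@[ext]
structure ColoredPerm (r n : ℕ) where
  /-- the color vector -/
  color : Fin n → ZMod r
  /-- the underlying permutation -/
  perm : Equiv.Perm (Fin n)

namespace ColoredPerm

variable {r n : ℕ}

instance : One (ColoredPerm r n) := ⟨⟨0, 1⟩⟩

/-- `(z, τ) (z', τ') = ((z_i + z'_{τ⁻¹(i)})_i, τ ∘ τ')`. -/
instance : Mul (ColoredPerm r n) :=
  ⟨fun a b => ⟨fun i => a.color i + b.color (a.perm⁻¹ i), a.perm * b.perm⟩⟩

instance : Inv (ColoredPerm r n) := ⟨fun a => ⟨fun i => -a.color (a.perm i), a.perm⁻¹⟩⟩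

@[simp] theorem one_color (i : Fin n) : (1 : ColoredPerm r n).color i = 0 := rfl
@[simp] theorem one_perm : (1 : ColoredPerm r n).perm = 1 := rfl
@[simp] theorem mul_color (a b : ColoredPerm r n) (i : Fin n) :
    (a * b).color i = a.color i + b.color (a.perm⁻¹ i) := rfl
@[simp] theorem mul_perm (a b : ColoredPerm r n) : (a * b).perm = a.perm * b.perm := rfl
@[simp] theorem inv_color (a : ColoredPerm r n) (i : Fin n) :
    a⁻¹.color i = -a.color (a.perm i) := rfl
@[simp] theorem inv_perm (a : ColoredPerm r n) : a⁻¹.perm = a.perm⁻¹ := rfl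

instance : Group (ColoredPerm r n) where
  mul_assoc a b c := by
    ext i <;> simp [add_assoc]
  one_mul a := by ext i <;> simp
  mul_one a := by ext i <;> simp
  inv_mul_cancel a := by ext i <;> simp

/-- A colored permutation is the same thing as a pair (color vector, permutation). -/
def equivProd : ColoredPerm r n ≃ (Fin n → ZMod r) × Equiv.Perm (Fin n) where
  toFun a := (a.color, a.perm)
  invFun p := ⟨p.1, p.2⟩
  left_inv _ := rfl
  right_inv _ := rfl

instance [NeZero r] : Fintype (ColoredPerm r n) := Fintype.ofEquiv _ equivProd.symm

/-- The Coxeter-like generators `s_0, …, s_{n-1}` of `G_{r,n}`: `s_0` adds one color to the first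
digit, and `s_i` (`1 ≤ i ≤ n - 1`) exchanges the `i`-th and the `(i+1)`-st digit, which are the
elements `i - 1` and `i` of `Fin n`. -/
def s (r : ℕ) {n : ℕ} (i : Fin n) : ColoredPerm r n :=
  if i.val = 0 then ⟨Pi.single i 1, 1⟩
  else ⟨0, Equiv.swap ⟨i.val - 1, lt_of_le_of_lt (Nat.sub_le _ _) i.isLt⟩ i⟩

/-- For even `r`, the homomorphism `φ : G_{r,n} → {1, -1}`, in closed form:
`φ(z, τ) = sign(τ) (-1)^{z_1 + ⋯ + z_n}` (`ZMod 2` acts on `{1, -1}` by powers).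
By `forall_eq_neg_one_iff_eq_phi` below it is the only homomorphism with `φ(s_i) = -1` for all `i`. -/
def phi (n : ℕ) (hr : Even r) : ColoredPerm r n →* ℤˣ where
  toFun a := Equiv.Perm.sign a.perm *
    (-1 : ℤˣ) ^ ZMod.castHom (even_iff_two_dvd.mp hr) (ZMod 2) (∑ i, a.color i)
  map_one' := by simp
  map_mul' a b := by
    have h : ∑ i, b.color (a.perm⁻¹ i) = ∑ i, b.color i :=
      Equiv.sum_comp (a.perm⁻¹ : Equiv.Perm (Fin n)) b.color
    simp only [mul_perm, map_mul, mul_color, Finset.sum_add_distrib, h, map_add, uzpow_add]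
    exact mul_mul_mul_comm _ _ _ _

theorem phi_s (hr : Even r) (i : Fin n) : phi n hr (s r i) = -1 := by
  unfold s
  split_ifs with h
  · have hsum : ∑ j, (Pi.single i 1 : Fin n → ZMod r) j = 1 := Fintype.sum_pi_single' i 1
    simp only [phi, MonoidHom.coe_mk, OneHom.coe_mk, hsum, map_one, uzpow_one, one_mul]
  · have hne : (⟨i.val - 1, lt_of_le_of_lt (Nat.sub_le _ _) i.isLt⟩ : Fin n) ≠ i := by
      intro e
      have := congrArg Fin.val e
      simp only at this
      omega
    simp [phi, Equiv.Perm.sign_swap hne]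

/-- The embedding of `S_n` into `G_{r,n}`. -/
def ofPerm : Equiv.Perm (Fin n) →* ColoredPerm r n where
  toFun τ := ⟨0, τ⟩
  map_one' := rfl
  map_mul' a b := by ext i <;> simp

/-- The embedding of the color vectors into `G_{r,n}`. -/
def ofColor : Multiplicative (Fin n → ZMod r) →* ColoredPerm r n where
  toFun z := ⟨z.toAdd, 1⟩
  map_one' := rfl
  map_mul' a b := by ext i <;> simp

theorem ofPerm_mem (m : ℕ) (τ : Equiv.Perm (Fin (m + 1))) :
    ofPerm τ ∈ Subgroup.closure (Set.range (s r : Fin (m + 1) → ColoredPerm r (m + 1))) := by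
  have h : Submonoid.closure (Set.range fun i : Fin m => Equiv.swap i.castSucc i.succ) ≤
      ((Subgroup.closure (Set.range (s r : Fin (m + 1) → ColoredPerm r (m + 1)))).comap
        ofPerm).toSubmonoid := by
    rw [Submonoid.closure_le]
    rintro _ ⟨i, rfl⟩
    refine Subgroup.subset_closure ⟨i.succ, ?_⟩
    simp only [s, Fin.val_succ, Nat.add_one_ne_zero, if_false]
    rfl
  rw [Equiv.Perm.mclosure_swap_castSucc_succ] at h
  exact h (Submonoid.mem_top τ)

/-- The elements `s_0, …, s_{n-1}` generate `G_{r,n}`. -/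
theorem closure_range_s (r n : ℕ) :
    Subgroup.closure (Set.range (s r : Fin n → ColoredPerm r n)) = ⊤ := by
  rw [eq_top_iff]
  rintro ⟨z, τ⟩ -
  obtain _ | m := n
  · have h : (⟨z, τ⟩ : ColoredPerm r 0) = 1 := by
      ext i
      · exact i.elim0
      · exact i.elim0
    rw [h]
    exact one_mem _
  have hsingle : ∀ i : Fin (m + 1),
      ofColor (Multiplicative.ofAdd (Pi.single i (1 : ZMod r))) ∈
        Subgroup.closure (Set.range (s r : Fin (m + 1) → ColoredPerm r (m + 1))) := by
    intro i
    have h : ofColor (Multiplicative.ofAdd (Pi.single i (1 : ZMod r))) =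
        ofPerm (Equiv.swap 0 i) * s r 0 * (ofPerm (Equiv.swap 0 i))⁻¹ := by
      ext j
      · by_cases hj : j = i
        · subst hj
          simp [ofColor, ofPerm, s]
        · have h' : Equiv.swap 0 i j ≠ 0 := by
            intro e
            apply hj
            rw [← Equiv.swap_apply_self 0 i j, e, Equiv.swap_apply_left]
          simp [ofColor, ofPerm, s, Pi.single_eq_of_ne hj, Pi.single_eq_of_ne h']
      · simp [ofColor, ofPerm, s]
    rw [h]
    exact mul_mem (mul_mem (ofPerm_mem m _) (Subgroup.subset_closure ⟨0, rfl⟩))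
      (inv_mem (ofPerm_mem m _))
  have hcolor : ofColor (Multiplicative.ofAdd z) ∈
      Subgroup.closure (Set.range (s r : Fin (m + 1) → ColoredPerm r (m + 1))) := by
    rw [← Finset.univ_sum_single z, ofAdd_sum, ← Subgroup.mem_comap]
    refine Subgroup.prod_mem _ fun i _ => ?_
    obtain ⟨c, hc⟩ := ZMod.intCast_surjective (z i)
    have h : Pi.single i (z i) = c • (Pi.single i 1 : Fin (m + 1) → ZMod r) := by
      rw [← Pi.single_smul, ← hc]
      simp
    rw [h, ofAdd_zsmul, Subgroup.mem_comap, map_zpow]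
    exact Subgroup.zpow_mem _ (hsingle i) c
  have h : (⟨z, τ⟩ : ColoredPerm r (m + 1)) = ofColor (Multiplicative.ofAdd z) * ofPerm τ := by
    ext i <;> simp [ofColor, ofPerm]
  rw [h]
  exact mul_mem hcolor (ofPerm_mem m τ)

/-- `φ` is the unique homomorphism to `{1, -1}` that sends every generator `s_i` to `-1`. -/
theorem forall_eq_neg_one_iff_eq_phi (hr : Even r) (f : ColoredPerm r n →* ℤˣ) :
    (∀ i, f (s r i) = -1) ↔ f = phi n hr := by
  constructor
  · intro h
    refine MonoidHom.eq_of_eqOn_dense (closure_range_s r n) ?_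
    rintro _ ⟨i, rfl⟩
    rw [h, phi_s]
  · rintro rfl i
    exact phi_s hr i

/-- The group of alternating colored permutations `A_{r,n} = ker φ` (for even `r`). -/
def alternating (n : ℕ) (hr : Even r) : Subgroup (ColoredPerm r n) := (phi n hr).ker

instance [NeZero r] (hr : Even r) : Fintype (alternating n hr) :=
  inferInstanceAs (Fintype (phi n hr).ker)

/-- `a_0 = s_0 ^ 2`, and `a_i = s_0 ^ (r / 2) * s_i` for `1 ≤ i ≤ n - 1`. -/
def a (r : ℕ) {n : ℕ} (i : Fin n) : ColoredPerm r n :=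
  if i.val = 0 then s r i ^ 2 else s r ⟨0, i.pos⟩ ^ (r / 2) * s r i

/-- The set `𝒜 = {a_0, a_1, a_1⁻¹, a_2, …, a_{n-1}}` (just `{a_0}` if `n = 1`). -/
def genSet (r n : ℕ) : Set (ColoredPerm r n) :=
  {g | ∃ i : Fin n, g = a r i ∨ (i.val = 1 ∧ g = (a r i)⁻¹)}

end ColoredPerm

/-- The length of `g` with respect to a set `S`: the least `u` such that `g` is a product of `u`
elements of `S` (`0` by convention if there is no such product). -/
noncomputable def wordLength {G : Type*} [Monoid G] (S : Set G) (g : G) : ℕ :=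
  sInf {u | ∃ w : List G, (∀ x ∈ w, x ∈ S) ∧ w.prod = g ∧ w.length = u}

/-- `[n]!_q = ∏_{j=1}^n (1 + q + ⋯ + q^{j-1})`, as a polynomial in `q = X`. -/
noncomputable def qFactorial (n : ℕ) : Polynomial ℚ :=
  ∏ j ∈ Finset.Icc 1 n, ∑ i ∈ Finset.range j, Polynomial.X ^ i

/-- The number of inversions of a finite sequence of integers. -/
def invNum {n : ℕ} (f : Fin n → ℤ) : ℕ :=
  ∑ i, ∑ j, if i < j ∧ f j < f i then 1 else 0

theorem invNum_succ {n : ℕ} (f : Fin (n + 1) → ℤ) :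
    invNum f = (∑ j : Fin n, if f j.succ < f 0 then 1 else 0) + invNum (fun i => f i.succ) := by
  simp only [invNum, Fin.sum_univ_succ (n := n), false_and, if_false, zero_add,
    Fin.succ_pos, true_and, Fin.not_lt_zero, Fin.succ_lt_succ_iff]

theorem castSucc_lt_succ_swap {n : ℕ} (a : Fin n) (i j : Fin (n + 1))
    (h : ¬(i = a.castSucc ∧ j = a.succ)) (h' : ¬(i = a.succ ∧ j = a.castSucc)) :
    Equiv.swap a.castSucc a.succ i < Equiv.swap a.castSucc a.succ j ↔ i < j := by
  simp only [Equiv.swap_apply_def, Fin.ext_iff, Fin.val_castSucc, Fin.val_succ] at *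
  split_ifs <;> simp only [Fin.lt_def, Fin.val_castSucc, Fin.val_succ] <;> omega

theorem invNum_comp_swap {n : ℕ} (f : Fin (n + 1) → ℤ) (a : Fin n)
    (h : f a.succ < f a.castSucc) :
    invNum f = invNum (f ∘ Equiv.swap a.castSucc a.succ) + 1 := by
  set e := Equiv.swap a.castSucc a.succ with he
  have h1 : invNum (f ∘ e) = ∑ i, ∑ j, if e i < e j ∧ f j < f i then 1 else 0 := by
    rw [invNum, ← Equiv.sum_comp e (fun i => ∑ j, if e i < e j ∧ f j < f i then 1 else 0)]
    refine Finset.sum_congr rfl fun i _ => ?_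
    rw [← Equiv.sum_comp e (fun j => if e (e i) < e j ∧ f j < f (e i) then 1 else 0)]
    simp [he]
  have h2 : (1 : ℕ) = ∑ i, ∑ j, if i = a.castSucc ∧ j = a.succ then 1 else 0 := by
    simp [ite_and]
  refine Eq.trans ?_ (congrArg₂ (· + ·) h1 h2).symm
  rw [invNum, ← Finset.sum_add_distrib]
  refine Finset.sum_congr rfl fun i _ => ?_
  rw [← Finset.sum_add_distrib]
  refine Finset.sum_congr rfl fun j _ => ?_
  by_cases h3 : i = a.castSucc ∧ j = a.succ
  · obtain ⟨rfl, rfl⟩ := h3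
    simp [he, h, (Fin.castSucc_lt_succ (i := a)).le]
  by_cases h4 : i = a.succ ∧ j = a.castSucc
  · obtain ⟨rfl, rfl⟩ := h4
    simp [h.not_gt, (Fin.castSucc_lt_succ (i := a)).ne']
  simp only [he, castSucc_lt_succ_swap a i j h3 h4, h3, if_false, add_zero]

/-- The rank of an entry is uniformly distributed. -/
theorem sum_pow_rank {n : ℕ} (κ : Fin n → ℤ) (hκ : Function.Injective κ) (q : Polynomial ℚ) :
    ∑ p, q ^ (∑ j, if κ j < κ p then 1 else 0) = ∑ i ∈ Finset.range n, q ^ i := by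
  rw [← Fin.sum_univ_eq_sum_range (fun i => q ^ i)]
  have hlt : ∀ p, (∑ j, if κ j < κ p then 1 else 0) < n := by
    intro p
    rw [← Finset.card_filter]
    calc _ < (Finset.univ : Finset (Fin n)).card := by
          refine Finset.card_lt_card (Finset.filter_ssubset.2 ⟨p, Finset.mem_univ _, ?_⟩)
          simp
      _ = n := by simp
  have hmono : ∀ p p', κ p < κ p' →
      (∑ j, if κ j < κ p then 1 else 0) < (∑ j, if κ j < κ p' then 1 else 0) := by
    intro p p' h
    simp only [← Finset.card_filter]
    refine Finset.card_lt_card ⟨?_, ?_⟩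
    · intro j
      simp only [Finset.mem_filter, Finset.mem_univ, true_and]
      exact fun h' => h'.trans h
    · intro h'
      simpa using h' (show p ∈ _ by simpa using h)
  let g : Fin n → Fin n := fun p => ⟨_, hlt p⟩
  have hg : Function.Injective g := by
    intro p p' h
    have h' := congrArg Fin.val h
    rcases lt_trichotomy (κ p) (κ p') with h1 | h1 | h1
    · exact absurd h' (hmono _ _ h1).ne
    · exact hκ h1
    · exact absurd h' (hmono _ _ h1).ne'
  exact (Finite.injective_iff_bijective.1 hg).sum_comp (fun i : Fin n => q ^ i.val)

/-- The inversion number is Mahonian on the rearrangements of a sequence of distinct integers. -/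
theorem sum_pow_invNum {n : ℕ} (κ : Fin n → ℤ) (hκ : Function.Injective κ) :
    ∑ σ : Equiv.Perm (Fin n), (Polynomial.X : Polynomial ℚ) ^ invNum (fun i => κ (σ i)) =
      qFactorial n := by
  induction n with
  | zero => simp [qFactorial, invNum]
  | succ n ih =>
    rw [qFactorial, Finset.prod_Icc_succ_top (by omega), ← qFactorial,
      ← sum_pow_rank κ hκ, ← Equiv.sum_comp Equiv.Perm.decomposeFin.symm,
      Fintype.sum_prod_type, Finset.mul_sum]
    refine Finset.sum_congr rfl fun p _ => ?_
    rw [← ih (fun i => κ (Equiv.swap 0 p i.succ)), Finset.sum_mul]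
    · refine Finset.sum_congr rfl fun σ _ => ?_
      rw [invNum_succ, pow_add, mul_comm]
      congr 2
      · simp
      · rw [← Equiv.sum_comp (Equiv.Perm.decomposeFin.symm (p, σ)), Fin.sum_univ_succ]
        simp
    · exact hκ.comp ((Equiv.injective _).comp (Fin.succ_injective _))

namespace ColoredPerm

/-- For `r = 2 (2k + 1)`, the least number of times `2` has to be added to `0` or to `r / 2` in
order to obtain the color `z`. -/
def colorWeight (k : ℕ) (z : ZMod (2 * (2 * k + 1))) : ℕ :=
  (((k + 1 : ℕ) : ZMod (2 * k + 1)) * ZMod.castHom (dvd_mul_left _ 2) (ZMod (2 * k + 1)) z).val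

theorem half_mul_two (k : ℕ) : ((k + 1 : ℕ) : ZMod (2 * k + 1)) * 2 = 1 := by
  have h : ((2 * k + 1 : ℕ) : ZMod (2 * k + 1)) = 0 := ZMod.natCast_self _
  push_cast at h ⊢
  linear_combination h

@[simp] theorem colorWeight_zero (k : ℕ) : colorWeight k 0 = 0 := by
  simp [colorWeight]

theorem colorWeight_add_half (k : ℕ) (z : ZMod (2 * (2 * k + 1))) :
    colorWeight k (z + ((2 * k + 1 : ℕ) : ZMod (2 * (2 * k + 1)))) = colorWeight k z := by
  rw [colorWeight, map_add, map_natCast, ZMod.natCast_self, add_zero, colorWeight]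

theorem colorWeight_add_two (k : ℕ) (z : ZMod (2 * (2 * k + 1))) :
    colorWeight k (z + 2) ≤ colorWeight k z + 1 := by
  rw [colorWeight, map_add, map_ofNat, mul_add, half_mul_two]
  refine (ZMod.val_add_le _ _).trans (Nat.add_le_add_left ?_ _)
  rw [← Nat.cast_one (R := ZMod (2 * k + 1)), ZMod.val_natCast]
  exact Nat.mod_le _ _

theorem colorWeight_sub_two (k : ℕ) (z : ZMod (2 * (2 * k + 1))) (h : colorWeight k z ≠ 0) :
    colorWeight k (z - 2) + 1 = colorWeight k z := by
  rw [colorWeight, map_sub, map_ofNat, mul_sub, half_mul_two]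
  unfold colorWeight at h ⊢
  set x := ((k + 1 : ℕ) : ZMod (2 * k + 1)) *
    ZMod.castHom (dvd_mul_left _ 2) (ZMod (2 * k + 1)) z
  obtain ⟨d, hd⟩ := Nat.exists_eq_succ_of_ne_zero h
  have hx : x - 1 = (d : ZMod (2 * k + 1)) := by
    rw [← ZMod.natCast_zmod_val x, hd]
    simp
  have := ZMod.val_lt x
  rw [hx, ZMod.val_natCast_of_lt (by omega), hd]

theorem eq_half_of_colorWeight_eq_zero (k : ℕ) (z : ZMod (2 * (2 * k + 1))) (hz : z ≠ 0)
    (h : colorWeight k z = 0) : z = ((2 * k + 1 : ℕ) : ZMod (2 * (2 * k + 1))) := by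
  rw [colorWeight, ZMod.val_eq_zero] at h
  have h1 : ZMod.castHom (dvd_mul_left _ 2) (ZMod (2 * k + 1)) z = 0 := by
    have h2 := half_mul_two k
    linear_combination 2 * h - ZMod.castHom (dvd_mul_left _ 2) (ZMod (2 * k + 1)) z * h2
  rw [← ZMod.natCast_zmod_val z, map_natCast, ZMod.natCast_eq_zero_iff] at h1
  obtain ⟨c, hc⟩ := h1
  have hlt := ZMod.val_lt z
  have hpos : z.val ≠ 0 := by simpa using hz
  rw [hc] at hlt hpos
  have hc1 : c = 1 := by
    have : c < 2 := by nlinarith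
    have : c ≠ 0 := by rintro rfl; simp at hpos
    omega
  rw [← ZMod.natCast_zmod_val z, hc, hc1, mul_one]

theorem sum_pow_colorWeight (k : ℕ) (q : Polynomial ℚ) :
    ∑ z, q ^ colorWeight k z = 2 * ∑ i ∈ Finset.range (2 * k + 1), q ^ i := by
  have hc : Nat.Coprime 2 (2 * k + 1) := by simp
  have hu := half_mul_two k
  let e : ZMod (2 * k + 1) ≃ ZMod (2 * k + 1) :=
    { toFun := fun x => ((k + 1 : ℕ) : ZMod (2 * k + 1)) * x
      invFun := fun x => 2 * x
      left_inv := fun x => by linear_combination x * hu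
      right_inv := fun x => by linear_combination x * hu }
  have h1 : ∀ z, q ^ colorWeight k z =
      (fun p : ZMod 2 × ZMod (2 * k + 1) => q ^ (e p.2).val)
        ((ZMod.chineseRemainder hc).toEquiv z) := by
    intro z
    rfl
  rw [Finset.sum_congr rfl fun z _ => h1 z]
  refine (Equiv.sum_comp (ZMod.chineseRemainder hc).toEquiv
    (fun p : ZMod 2 × ZMod (2 * k + 1) => q ^ (e p.2).val)).trans ?_
  rw [Fintype.sum_prod_type]
  simp only [Finset.sum_const, Finset.card_univ, ZMod.card, nsmul_eq_mul]
  rw [Equiv.sum_comp e (fun x => q ^ x.val)]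
  congr 1
  exact Fin.sum_univ_eq_sum_range (fun i => q ^ i) (2 * k + 1)

theorem sum_pow_colorWeight_ne_zero (k : ℕ) (q : Polynomial ℚ) :
    ∑ z ∈ Finset.univ.erase 0, q ^ colorWeight k z = 1 + ∑ i ∈ Finset.Icc 1 (2 * k), 2 * q ^ i := by
  have h := sum_pow_colorWeight k q
  rw [← Finset.add_sum_erase _ _ (Finset.mem_univ 0), colorWeight_zero,
    Finset.range_eq_Ico, Finset.sum_eq_sum_Ico_succ_bot (by omega)] at h
  rw [← Finset.mul_sum]
  have h2 : Finset.Ico (0 + 1) (2 * k + 1) = Finset.Icc 1 (2 * k) := by ext; simp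
  rw [h2] at h
  linear_combination h

variable {k n : ℕ}

/-- The element that adds `c` to the color of the first digit. -/
def colorShift {r n : ℕ} (c : ZMod r) : ColoredPerm r (n + 1) := ⟨Pi.single 0 c, 1⟩

/-- The element that exchanges two adjacent digits. -/
def adjSwap {r n : ℕ} (j : Fin n) : ColoredPerm r (n + 1) :=
  ⟨0, Equiv.swap j.castSucc j.succ⟩

/-- The involution `s_0 ^ (r / 2)` for `r = 2 (2k + 1)`. -/
def halfShift : ColoredPerm (2 * (2 * k + 1)) (n + 1) := colorShift ((2 * k + 1 : ℕ) : ZMod _)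

theorem colorShift_mul {r n : ℕ} (c d : ZMod r) :
    (colorShift c * colorShift d : ColoredPerm r (n + 1)) = colorShift (c + d) := by
  ext i
  · rw [mul_color]
    simp only [colorShift, inv_one, Equiv.Perm.one_apply, Pi.single_add, Pi.add_apply]
  · simp [colorShift]

theorem colorShift_zero {r n : ℕ} : (colorShift 0 : ColoredPerm r (n + 1)) = 1 := by
  ext i <;> simp [colorShift]

theorem colorShift_one_pow {r n : ℕ} (c : ℕ) :
    (colorShift 1 : ColoredPerm r (n + 1)) ^ c = colorShift (c : ZMod r) := by
  induction c with
  | zero => simp [colorShift_zero]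
  | succ c ih => rw [pow_succ, ih, colorShift_mul, Nat.cast_succ]

theorem halfShift_mul_self :
    (halfShift * halfShift : ColoredPerm (2 * (2 * k + 1)) (n + 1)) = 1 := by
  rw [halfShift, colorShift_mul, ← Nat.cast_add, ← two_mul, ZMod.natCast_self, colorShift_zero]

theorem halfShift_inv :
    (halfShift : ColoredPerm (2 * (2 * k + 1)) (n + 1))⁻¹ = halfShift :=
  inv_eq_of_mul_eq_one_left halfShift_mul_self

theorem adjSwap_mul_self {r n : ℕ} (j : Fin n) :
    (adjSwap j * adjSwap j : ColoredPerm r (n + 1)) = 1 := by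
  ext i <;> simp [adjSwap]

theorem adjSwap_inv {r n : ℕ} (j : Fin n) :
    (adjSwap j : ColoredPerm r (n + 1))⁻¹ = adjSwap j :=
  inv_eq_of_mul_eq_one_left (adjSwap_mul_self j)

theorem adjSwap_mul_colorShift {r n : ℕ} (j : Fin n) (hj : j.val ≠ 0) (c : ZMod r) :
    (adjSwap j * colorShift c : ColoredPerm r (n + 1)) = colorShift c * adjSwap j := by
  ext i
  · have h : Equiv.swap j.castSucc j.succ i = 0 ↔ i = 0 := by
      rw [← Equiv.eq_symm_apply, Equiv.symm_swap, Equiv.swap_apply_of_ne_of_ne]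
      · simpa [Fin.ext_iff] using hj.symm
      · exact (Fin.succ_ne_zero j).symm
    simp [adjSwap, colorShift, Pi.single_apply, h]
  · simp [adjSwap, colorShift]

theorem s_zero (r n : ℕ) : (s r 0 : ColoredPerm r (n + 1)) = colorShift 1 := rfl

theorem s_succ (r : ℕ) {n : ℕ} (j : Fin n) : s r j.succ = adjSwap j := by
  simp only [s, Fin.val_succ, Nat.add_one_ne_zero, if_false]
  rfl

theorem a_zero (r n : ℕ) : (a r 0 : ColoredPerm r (n + 1)) = colorShift 2 := by
  rw [a, if_pos (by simp), s_zero, colorShift_one_pow, Nat.cast_two]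

theorem a_succ (j : Fin n) : a (2 * (2 * k + 1)) j.succ = halfShift * adjSwap j := by
  rw [a, if_neg (by simp), s_succ, show (⟨0, j.succ.pos⟩ : Fin (n + 1)) = 0 from rfl, s_zero,
    colorShift_one_pow, Nat.mul_div_cancel_left _ two_pos]
  rfl

theorem colorShift_two_mem (r n : ℕ) : (colorShift 2 : ColoredPerm r (n + 1)) ∈ genSet r (n + 1) :=
  ⟨0, Or.inl (a_zero r n).symm⟩

theorem halfShift_mul_adjSwap_mem (j : Fin n) :
    (halfShift * adjSwap j : ColoredPerm (2 * (2 * k + 1)) (n + 1)) ∈ genSet _ (n + 1) :=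
  ⟨j.succ, Or.inl (a_succ j).symm⟩

theorem adjSwap_mul_halfShift_mem (j : Fin n) :
    (adjSwap j * halfShift : ColoredPerm (2 * (2 * k + 1)) (n + 1)) ∈ genSet _ (n + 1) := by
  by_cases hj : j.val = 0
  · refine ⟨j.succ, Or.inr ⟨by simp [hj], ?_⟩⟩
    rw [a_succ, mul_inv_rev, adjSwap_inv, halfShift_inv]
  · rw [halfShift, adjSwap_mul_colorShift j hj]
    exact halfShift_mul_adjSwap_mem j

theorem eq_of_mem_genSet {g : ColoredPerm (2 * (2 * k + 1)) (n + 1)} (hg : g ∈ genSet _ (n + 1)) :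
    g = colorShift 2 ∨ ∃ j, g = halfShift * adjSwap j ∨ g = adjSwap j * halfShift := by
  obtain ⟨i, hi⟩ := hg
  induction i using Fin.cases with
  | zero =>
    left
    rcases hi with h | h
    · rw [h, a_zero]
    · simp at h
  | succ j =>
    right
    refine ⟨j, hi.imp (fun h => h.trans (a_succ j)) fun h => h.2.trans ?_⟩
    rw [a_succ, mul_inv_rev, adjSwap_inv, halfShift_inv]

/-- The sequence of integers whose inversions enter the length function: a colored digit `v`
counts as `-v - 1` (with digits starting from `0`). -/
def key {r n : ℕ} (g : ColoredPerm r n) (i : Fin n) : ℤ :=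
  if g.color i = 0 then ((g.perm⁻¹ i).val : ℤ) else -((g.perm⁻¹ i).val : ℤ) - 1

/-- The combinatorial length function on the colored permutations, for `r = 2 (2k + 1)`. -/
def invLength (g : ColoredPerm (2 * (2 * k + 1)) n) : ℕ :=
  invNum (key g) +
    ∑ i, if g.color i = 0 then 0 else (g.perm⁻¹ i).val + colorWeight k (g.color i)

/-- The part of `invLength` that is not affected by the color of the first digit. -/
def restLength (z : Fin n → ZMod (2 * (2 * k + 1))) (σ : Equiv.Perm (Fin (n + 1))) : ℕ :=
  (∑ j, if z j = 0 ∧ σ 0 < σ j.succ then 0 else 1) +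
    invNum (fun j => if z j = 0 then ((σ j.succ).val : ℤ) else -((σ j.succ).val : ℤ) - 1) +
    ∑ j, if z j = 0 then 0 else (σ j.succ).val + colorWeight k (z j)

theorem sum_ite_apply_succ_lt (σ : Equiv.Perm (Fin (n + 1))) :
    (∑ j : Fin n, if σ j.succ < σ 0 then 1 else 0) = (σ 0).val := by
  have h := Fin.sum_univ_succ (fun j => if σ j < σ 0 then 1 else 0)
  rw [if_neg (lt_irrefl _), zero_add, Equiv.sum_comp σ (fun j => if j < σ 0 then 1 else 0)] at h
  rw [← h, ← Finset.card_filter, Finset.filter_gt_eq_Iio, Fin.card_Iio]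

theorem invLength_eq (g : ColoredPerm (2 * (2 * k + 1)) (n + 1)) :
    invLength g =
      colorWeight k (g.color 0) + restLength (fun j => g.color j.succ) g.perm⁻¹ := by
  have hne : ∀ j : Fin n, (g.perm⁻¹ j.succ).val ≠ (g.perm⁻¹ 0).val := fun j h =>
    Fin.succ_ne_zero j ((Equiv.injective _) (Fin.ext h))
  rw [invLength, invNum_succ, Fin.sum_univ_succ, restLength]
  unfold key
  by_cases h0 : g.color 0 = 0
  · simp only [h0, if_true, colorWeight_zero, zero_add]
    congr 2
    refine Finset.sum_congr rfl fun j _ => ?_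
    have := hne j
    by_cases hj : g.color j.succ = 0 <;>
      simp only [hj, if_true, if_false, true_and, false_and, Fin.lt_def] <;> split_ifs <;> omega
  · simp only [h0, if_false]
    have h1 : (∑ j : Fin n, if (if g.color j.succ = 0 then ((g.perm⁻¹ j.succ).val : ℤ)
          else -((g.perm⁻¹ j.succ).val : ℤ) - 1) < -((g.perm⁻¹ 0).val : ℤ) - 1 then 1 else 0) +
        (g.perm⁻¹ 0).val =
        ∑ j : Fin n, if g.color j.succ = 0 ∧ g.perm⁻¹ 0 < g.perm⁻¹ j.succ then 0 else 1 := by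
      refine (congrArg _ (sum_ite_apply_succ_lt g.perm⁻¹).symm).trans ?_
      rw [← Finset.sum_add_distrib]
      refine Finset.sum_congr rfl fun j _ => ?_
      have := hne j
      by_cases hj : g.color j.succ = 0 <;>
        simp only [hj, if_true, if_false, true_and, false_and, Fin.lt_def] <;> split_ifs <;> omega
    rw [← h1]
    ring

theorem colorShift_mul_color_zero {r : ℕ} (c : ZMod r) (g : ColoredPerm r (n + 1)) :
    (colorShift c * g).color 0 = g.color 0 + c := by
  simp [colorShift, add_comm]

theorem colorShift_mul_color_succ {r : ℕ} (c : ZMod r) (g : ColoredPerm r (n + 1)) (j : Fin n) :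
    (colorShift c * g).color j.succ = g.color j.succ := by
  simp [colorShift]

theorem colorShift_mul_perm {r : ℕ} (c : ZMod r) (g : ColoredPerm r (n + 1)) :
    (colorShift c * g).perm = g.perm := by
  simp [colorShift]

theorem invLength_colorShift_mul (c : ZMod (2 * (2 * k + 1)))
    (g : ColoredPerm (2 * (2 * k + 1)) (n + 1)) :
    invLength (colorShift c * g) + colorWeight k (g.color 0) =
      invLength g + colorWeight k (g.color 0 + c) := by
  simp only [invLength_eq, colorShift_mul_color_zero, colorShift_mul_color_succ,
    colorShift_mul_perm]
  ring

theorem invLength_halfShift_mul (g : ColoredPerm (2 * (2 * k + 1)) (n + 1)) :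
    invLength (halfShift * g) = invLength g := by
  have h := invLength_colorShift_mul ((2 * k + 1 : ℕ) : ZMod (2 * (2 * k + 1))) g
  rw [colorWeight_add_half] at h
  exact Nat.add_right_cancel h

theorem invLength_colorShift_two_mul_le (g : ColoredPerm (2 * (2 * k + 1)) (n + 1)) :
    invLength (colorShift 2 * g) ≤ invLength g + 1 := by
  have h := invLength_colorShift_mul 2 g
  have := colorWeight_add_two k (g.color 0)
  omega

theorem adjSwap_mul_color {r : ℕ} (j : Fin n) (g : ColoredPerm r (n + 1)) (i : Fin (n + 1)) :
    (adjSwap j * g).color i = g.color (Equiv.swap j.castSucc j.succ i) := by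
  simp [adjSwap]

theorem key_adjSwap_mul {r : ℕ} (j : Fin n) (g : ColoredPerm r (n + 1)) :
    key (adjSwap j * g) = key g ∘ Equiv.swap j.castSucc j.succ := by
  ext i
  simp [key, adjSwap]

theorem key_injective {r : ℕ} (g : ColoredPerm r n) : Function.Injective (key g) := by
  intro i j h
  apply (Equiv.injective g.perm⁻¹)
  apply Fin.ext
  unfold key at h
  split_ifs at h <;> omega

theorem invLength_adjSwap_mul (j : Fin n) (g : ColoredPerm (2 * (2 * k + 1)) (n + 1))
    (h : key g j.succ < key g j.castSucc) : invLength g = invLength (adjSwap j * g) + 1 := by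
  unfold invLength
  rw [key_adjSwap_mul, invNum_comp_swap _ j h,
    ← Equiv.sum_comp (Equiv.swap j.castSucc j.succ)
      (fun i => if g.color i = 0 then 0 else (g.perm⁻¹ i).val + colorWeight k (g.color i))]
  simp only [adjSwap_mul_color]
  simp only [adjSwap, mul_perm, mul_inv_rev, Equiv.swap_inv, Equiv.Perm.mul_apply]
  ring

theorem invLength_adjSwap_mul_le (j : Fin n) (g : ColoredPerm (2 * (2 * k + 1)) (n + 1)) :
    invLength (adjSwap j * g) ≤ invLength g + 1 := by
  rcases lt_trichotomy (key g j.succ) (key g j.castSucc) with h | h | h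
  · have := invLength_adjSwap_mul j g h
    omega
  · exact absurd (key_injective g h) (Fin.castSucc_lt_succ (i := j)).ne'
  · have := invLength_adjSwap_mul j (adjSwap j * g) (by simpa [key_adjSwap_mul] using h)
    rw [← mul_assoc, adjSwap_mul_self, one_mul] at this
    omega

theorem invLength_mul_le {x : ColoredPerm (2 * (2 * k + 1)) (n + 1)} (hx : x ∈ genSet _ (n + 1))
    (g : ColoredPerm (2 * (2 * k + 1)) (n + 1)) : invLength (x * g) ≤ invLength g + 1 := by
  rcases eq_of_mem_genSet hx with rfl | ⟨j, rfl | rfl⟩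
  · exact invLength_colorShift_two_mul_le g
  · rw [mul_assoc, invLength_halfShift_mul]
    exact invLength_adjSwap_mul_le j g
  · rw [mul_assoc]
    exact (invLength_adjSwap_mul_le j _).trans_eq (by rw [invLength_halfShift_mul])

theorem invLength_one : invLength (1 : ColoredPerm (2 * (2 * k + 1)) n) = 0 := by
  simp only [invLength, invNum, key, one_color, one_perm, inv_one, Equiv.Perm.one_apply, if_true,
    Finset.sum_const_zero, add_zero]
  refine Finset.sum_eq_zero fun i _ => Finset.sum_eq_zero fun j _ => if_neg ?_
  rw [Fin.lt_def]
  omega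

theorem invLength_prod_le (w : List (ColoredPerm (2 * (2 * k + 1)) (n + 1)))
    (hw : ∀ x ∈ w, x ∈ genSet _ (n + 1)) : invLength w.prod ≤ w.length := by
  induction w with
  | nil => simp [invLength_one]
  | cons x w ih =>
    rw [List.prod_cons, List.length_cons]
    exact (invLength_mul_le (hw x (by simp)) _).trans
      (Nat.add_le_add_right (ih fun y hy => hw y (by simp [hy])) 1)

/-- The number of colored digits. -/
def coloredCount {r n : ℕ} (g : ColoredPerm r n) : ℕ := ∑ i, if g.color i = 0 then 0 else 1

theorem coloredCount_adjSwap_mul {r : ℕ} (j : Fin n) (g : ColoredPerm r (n + 1)) :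
    coloredCount (adjSwap j * g) = coloredCount g := by
  unfold coloredCount
  simp only [adjSwap_mul_color]
  exact Equiv.sum_comp (Equiv.swap j.castSucc j.succ) (fun i => if g.color i = 0 then 0 else 1)

theorem coloredCount_colorShift_mul_le {r : ℕ} (c : ZMod r) (g : ColoredPerm r (n + 1))
    (h : g.color 0 ≠ 0) : coloredCount (colorShift c * g) ≤ coloredCount g := by
  unfold coloredCount
  simp only [Fin.sum_univ_succ, colorShift_mul_color_succ, h, if_false]
  gcongr
  split_ifs <;> simp

theorem coloredCount_colorShift_neg_mul {r : ℕ} (g : ColoredPerm r (n + 1))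
    (h : g.color 0 ≠ 0) : coloredCount (colorShift (-g.color 0) * g) + 1 = coloredCount g := by
  unfold coloredCount
  simp only [Fin.sum_univ_succ, colorShift_mul_color_succ, colorShift_mul_color_zero, h, if_false]
  simp [add_comm]

theorem eq_one_of_key_le {r : ℕ} (g : ColoredPerm r (n + 1)) (h0 : g.color 0 = 0)
    (h : ∀ j : Fin n, key g j.castSucc ≤ key g j.succ) : g = 1 := by
  have hm : Monotone (key g) := Fin.monotone_iff_le_succ.2 h
  have hc : ∀ i, g.color i = 0 := by
    intro i
    by_contra hi
    have := hm (Fin.zero_le i)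
    rw [key, key, if_pos h0, if_neg hi] at this
    omega
  have hs : StrictMono (g.perm⁻¹ : Equiv.Perm (Fin (n + 1))) := by
    refine Monotone.strictMono_of_injective (fun i j hij => ?_) (Equiv.injective _)
    have := hm hij
    rw [key, key, if_pos (hc i), if_pos (hc j)] at this
    rw [Fin.le_def]
    omega
  have hp : g.perm⁻¹ = 1 := by
    apply Equiv.coe_fn_injective
    refine hs.range_inj strictMono_id |>.1 ?_
    rw [Set.range_id, (Equiv.surjective _).range_eq]
  ext i
  · simp [hc]
  · rw [inv_eq_one.1 hp, one_perm]

theorem exists_prod_eq (g : ColoredPerm (2 * (2 * k + 1)) (n + 1)) :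
    ∃ w : List (ColoredPerm (2 * (2 * k + 1)) (n + 1)), (∀ x ∈ w, x ∈ genSet _ (n + 1)) ∧
      w.length = invLength g ∧ (w.prod = g ∨ halfShift * w.prod = g) := by
  induction hN : invLength g + coloredCount g using Nat.strong_induction_on generalizing g with
  | _ N ih =>
    subst hN
    by_cases hd : ∃ j : Fin n, key g j.succ < key g j.castSucc
    · obtain ⟨j, hj⟩ := hd
      have hl := invLength_adjSwap_mul j g hj
      obtain ⟨w, hw, hlen, hprod⟩ := ih _ (by rw [coloredCount_adjSwap_mul, hl]; omega)
        (adjSwap j * g) rfl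
      rcases hprod with h | h
      · refine ⟨(halfShift * adjSwap j) :: w, ?_, by rw [List.length_cons, hlen, hl], Or.inr ?_⟩
        · simpa [halfShift_mul_adjSwap_mem j] using hw
        · rw [List.prod_cons, h, ← mul_assoc, ← mul_assoc halfShift halfShift, halfShift_mul_self,
            one_mul, ← mul_assoc, adjSwap_mul_self, one_mul]
      · refine ⟨(adjSwap j * halfShift) :: w, ?_, by rw [List.length_cons, hlen, hl], Or.inl ?_⟩
        · simpa [adjSwap_mul_halfShift_mem j] using hw
        · rw [List.prod_cons, mul_assoc, h, ← mul_assoc, adjSwap_mul_self, one_mul]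
    push Not at hd
    by_cases h0 : g.color 0 = 0
    · rw [eq_one_of_key_le g h0 hd]
      exact ⟨[], by simp, by simp [invLength_one], Or.inl rfl⟩
    by_cases hw0 : colorWeight k (g.color 0) = 0
    · have hc := coloredCount_colorShift_neg_mul g h0
      have hz := eq_half_of_colorWeight_eq_zero k _ h0 hw0
      have hneg : (colorShift (-g.color 0) : ColoredPerm (2 * (2 * k + 1)) (n + 1)) =
          halfShift := by
        rw [← halfShift_inv, eq_comm]
        refine inv_eq_of_mul_eq_one_left ?_
        rw [halfShift, ← hz, colorShift_mul, neg_add_cancel, colorShift_zero]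
      rw [hneg] at hc
      have hl := invLength_halfShift_mul g
      obtain ⟨w, hw, hlen, hprod⟩ := ih _ (by omega) (halfShift * g) rfl
      refine ⟨w, hw, hlen.trans hl, ?_⟩
      rcases hprod with h | h
      · right
        rw [h, ← mul_assoc, halfShift_mul_self, one_mul]
      · exact Or.inl (mul_left_cancel h)
    · have hl := invLength_colorShift_mul (-2) g
      rw [← sub_eq_add_neg] at hl
      have hl' := colorWeight_sub_two k _ hw0
      have hc := coloredCount_colorShift_mul_le (-2) g h0
      obtain ⟨w, hw, hlen, hprod⟩ := ih _ (by omega) (colorShift (-2) * g) rfl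
      refine ⟨colorShift 2 :: w, ?_, by rw [List.length_cons, hlen]; omega, ?_⟩
      · simpa [colorShift_two_mem] using hw
      have hg : colorShift 2 * (colorShift (-2) * g) = g := by
        rw [← mul_assoc, colorShift_mul, add_neg_cancel, colorShift_zero, one_mul]
      rw [List.prod_cons]
      refine hprod.imp (fun h => by rw [h, hg]) fun h => ?_
      have hcomm : halfShift * colorShift 2 =
          (colorShift 2 * halfShift : ColoredPerm (2 * (2 * k + 1)) (n + 1)) := by
        simp only [halfShift, colorShift_mul, add_comm]
      rw [← mul_assoc, hcomm, mul_assoc, h, hg]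

theorem phi_adjSwap (hr : Even (2 * (2 * k + 1))) (j : Fin n) :
    phi (n + 1) hr (adjSwap j) = -1 := by
  rw [← s_succ, phi_s]

theorem phi_colorShift_one_pow (hr : Even (2 * (2 * k + 1))) (c : ℕ) :
    phi (n + 1) hr (colorShift (c : ZMod _)) = (-1) ^ c := by
  rw [← colorShift_one_pow, map_pow, ← s_zero, phi_s]

theorem phi_halfShift (hr : Even (2 * (2 * k + 1))) : phi (n + 1) hr halfShift = -1 := by
  rw [halfShift, phi_colorShift_one_pow, Odd.neg_one_pow (odd_two_mul_add_one k)]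

theorem phi_eq_one_of_mem_genSet (hr : Even (2 * (2 * k + 1)))
    {x : ColoredPerm (2 * (2 * k + 1)) (n + 1)} (hx : x ∈ genSet _ (n + 1)) :
    phi (n + 1) hr x = 1 := by
  rcases eq_of_mem_genSet hx with rfl | ⟨j, rfl | rfl⟩
  · exact (phi_colorShift_one_pow hr 2).trans neg_one_sq
  · rw [map_mul, phi_halfShift, phi_adjSwap, neg_mul_neg, one_mul]
  · rw [map_mul, phi_halfShift, phi_adjSwap, neg_mul_neg, one_mul]

theorem closure_genSet_le (hr : Even (2 * (2 * k + 1))) :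
    Submonoid.closure (genSet (2 * (2 * k + 1)) (n + 1)) ≤
      (alternating (n + 1) hr).toSubmonoid :=
  Submonoid.closure_le.2 fun _ hx => phi_eq_one_of_mem_genSet hr hx

theorem exists_prod_eq_of_phi_eq_one (hr : Even (2 * (2 * k + 1)))
    {g : ColoredPerm (2 * (2 * k + 1)) (n + 1)} (hg : phi (n + 1) hr g = 1) :
    ∃ w : List (ColoredPerm (2 * (2 * k + 1)) (n + 1)), (∀ x ∈ w, x ∈ genSet _ (n + 1)) ∧
      w.prod = g ∧ w.length = invLength g := by
  obtain ⟨w, hw, hlen, h | h⟩ := exists_prod_eq g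
  · exact ⟨w, hw, h, hlen⟩
  · have hp : phi (n + 1) hr w.prod = 1 :=
      closure_genSet_le hr (Submonoid.list_prod_mem _ fun x hx => Submonoid.subset_closure (hw x hx))
    rw [← h, map_mul, hp, phi_halfShift] at hg
    exact absurd hg (by decide)

theorem closure_genSet (hr : Even (2 * (2 * k + 1))) :
    Submonoid.closure (genSet (2 * (2 * k + 1)) (n + 1)) =
      (alternating (n + 1) hr).toSubmonoid := by
  refine le_antisymm (closure_genSet_le hr) fun g hg => ?_
  obtain ⟨w, hw, rfl, -⟩ := exists_prod_eq_of_phi_eq_one hr (show phi (n + 1) hr g = 1 from hg)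
  exact Submonoid.list_prod_mem _ fun x hx => Submonoid.subset_closure (hw x hx)

theorem wordLength_genSet (hr : Even (2 * (2 * k + 1)))
    {g : ColoredPerm (2 * (2 * k + 1)) (n + 1)} (hg : phi (n + 1) hr g = 1) :
    wordLength (genSet _ (n + 1)) g = invLength g := by
  refine IsLeast.csInf_eq ⟨exists_prod_eq_of_phi_eq_one hr hg, ?_⟩
  rintro _ ⟨w, hw, rfl, rfl⟩
  exact invLength_prod_le w hw

/-- A colored permutation is determined by the colors of its digits, indexed by the value of the
digit, and the sequence of the values. -/
def equivValueColor {r n : ℕ} :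
    (Fin n → ZMod r) × Equiv.Perm (Fin n) ≃ ColoredPerm r n where
  toFun p := ⟨fun i => p.1 (p.2 i), p.2⁻¹⟩
  invFun g := (fun v => g.color (g.perm v), g.perm⁻¹)
  left_inv p := by ext <;> simp
  right_inv g := by ext <;> simp

theorem sum_pow_invLength [NeZero (2 * (2 * k + 1))] :
    ∑ g : ColoredPerm (2 * (2 * k + 1)) n, (Polynomial.X : Polynomial ℚ) ^ invLength g =
      qFactorial n * ∏ j ∈ Finset.Icc 1 n, (1 + Polynomial.X ^ (j - 1) *
        (1 + ∑ i ∈ Finset.Icc 1 (2 * k), 2 * Polynomial.X ^ i)) := by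
  rw [← Equiv.sum_comp equivValueColor, Fintype.sum_prod_type]
  have h1 : ∀ (y : Fin n → ZMod (2 * (2 * k + 1))) (σ : Equiv.Perm (Fin n)),
      (Polynomial.X : Polynomial ℚ) ^ invLength (equivValueColor (y, σ)) =
        Polynomial.X ^ invNum (fun i => (fun v : Fin n => if y v = 0 then (v.val : ℤ)
          else -(v.val : ℤ) - 1) (σ i)) *
        ∏ v, Polynomial.X ^ (if y v = 0 then 0 else v.val + colorWeight k (y v)) := by
    intro y σ
    rw [Finset.prod_pow_eq_pow_sum, ← pow_add, ← Equiv.sum_comp σ]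
    rfl
  have h2 : ∀ y : Fin n → ZMod (2 * (2 * k + 1)), Function.Injective
      (fun v : Fin n => if y v = 0 then (v.val : ℤ) else -(v.val : ℤ) - 1) := by
    intro y v w h
    apply Fin.ext
    dsimp only at h
    split_ifs at h <;> omega
  simp only [h1, ← Finset.sum_mul]
  rw [Finset.sum_congr rfl fun y _ => by rw [sum_pow_invNum _ (h2 y)], ← Finset.mul_sum]
  congr 1
  rw [← Fintype.piFinset_univ, ← Finset.prod_univ_sum (fun _ => Finset.univ)
    (fun (v : Fin n) (c : ZMod (2 * (2 * k + 1))) =>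
      (Polynomial.X : Polynomial ℚ) ^ (if c = 0 then 0 else v.val + colorWeight k c))]
  rw [← Finset.Ico_succ_right_eq_Icc, Finset.prod_Ico_eq_prod_range]
  simp only [Order.succ_eq_add_one, Nat.add_sub_cancel, Nat.add_sub_cancel_left]
  rw [← Fin.prod_univ_eq_prod_range (fun j => (1 + (Polynomial.X : Polynomial ℚ) ^ j *
        (1 + ∑ i ∈ Finset.Icc 1 (2 * k), 2 * Polynomial.X ^ i)))]
  refine Finset.prod_congr rfl fun v _ => ?_
  rw [← Finset.add_sum_erase _ _ (Finset.mem_univ 0), if_pos rfl, pow_zero,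
    ← sum_pow_colorWeight_ne_zero, Finset.mul_sum]
  congr 1
  refine Finset.sum_congr rfl fun c hc => ?_
  rw [if_neg (Finset.ne_of_mem_erase hc), pow_add]

theorem two_mul_sum_alternating [NeZero (2 * (2 * k + 1))] (hr : Even (2 * (2 * k + 1))) :
    2 * ∑ π : alternating (n + 1) hr, (Polynomial.X : Polynomial ℚ) ^
        invLength (π : ColoredPerm (2 * (2 * k + 1)) (n + 1)) =
      ∑ g : ColoredPerm (2 * (2 * k + 1)) (n + 1), (Polynomial.X : Polynomial ℚ) ^ invLength g := by
  have h1 : ∑ π : alternating (n + 1) hr, (Polynomial.X : Polynomial ℚ) ^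
        invLength (π : ColoredPerm (2 * (2 * k + 1)) (n + 1)) =
      ∑ g : ColoredPerm (2 * (2 * k + 1)) (n + 1) with phi (n + 1) hr g = 1,
        (Polynomial.X : Polynomial ℚ) ^ invLength g :=
    (Finset.sum_subtype (p := fun g => g ∈ alternating (n + 1) hr) _
      (fun g => by simp [alternating, MonoidHom.mem_ker]) (fun g => Polynomial.X ^ invLength g)).symm
  rw [h1, two_mul, ← Finset.sum_filter_add_sum_filter_not Finset.univ
    (fun g => phi (n + 1) hr g = 1)]
  congr 1
  rw [Finset.sum_filter, Finset.sum_filter,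
    ← Equiv.sum_comp (Equiv.mulLeft (halfShift : ColoredPerm (2 * (2 * k + 1)) (n + 1)))
      (fun g => if ¬phi (n + 1) hr g = 1 then (Polynomial.X : Polynomial ℚ) ^ invLength g else 0)]
  refine Finset.sum_congr rfl fun g _ => ?_
  rw [Equiv.coe_mulLeft, invLength_halfShift_mul, map_mul, phi_halfShift]
  rcases Int.units_eq_one_or (phi (n + 1) hr g) with h | h <;> simp [h]

end ColoredPerm

theorem mainTheorem5 (r n : ℕ) [NeZero r] (hr : Even r) (hr4 : r % 4 = 2) (hn : 0 < n) :
    Submonoid.closure (ColoredPerm.genSet r n) = (ColoredPerm.alternating n hr).toSubmonoid ∧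
    ∑ π : ColoredPerm.alternating n hr,
        (Polynomial.X : Polynomial ℚ) ^ wordLength (ColoredPerm.genSet r n) (π : ColoredPerm r n) =
      Polynomial.C (1 / 2 : ℚ) * qFactorial n *
        ∏ j ∈ Finset.Icc 1 n,
          (1 + Polynomial.X ^ (j - 1) *
            (1 + ∑ i ∈ Finset.Icc 1 (r / 2 - 1), 2 * Polynomial.X ^ i)) := by
  obtain ⟨k, rfl⟩ : ∃ k, r = 2 * (2 * k + 1) := ⟨r / 4, by omega⟩
  obtain ⟨n, rfl⟩ := Nat.exists_eq_succ_of_ne_zero hn.ne'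
  refine ⟨ColoredPerm.closure_genSet hr, ?_⟩
  rw [Finset.sum_congr rfl fun π _ => by rw [ColoredPerm.wordLength_genSet hr π.2],
    Nat.mul_div_cancel_left _ two_pos, Nat.add_sub_cancel, mul_assoc,
    ← ColoredPerm.sum_pow_invLength, ← ColoredPerm.two_mul_sum_alternating hr, ← mul_assoc]
  have h : Polynomial.C (1 / 2 : ℚ) * 2 = 1 := by
    rw [← Polynomial.C_ofNat, ← Polynomial.C_mul]
    norm_num
  rw [h, one_mul]
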